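/- Let $\rho\ge 1$ be an integer and $n=\rho+1$. For $a\in\mathbb R^{k}$ and $b\in\mathbb R^{k+1}$ write $a\prec b$ if $b_1\le a_1\le b_2\le a_2\le\dots\le a_k\le b_{k+1}$. For ${\bf x}=(x_1<\dots<x_n)$ and ${\bf y}=(y_1\le\dots\le y_n)$ in $\mathbb R^n$, let the double cone $\mathcal C^{(\rho+1)}_{{\bf x},{\bf y}}\subset\mathbb R^{n(n-1)}$ be the set of all $({\bf x}^{(k)},{\bf y}^{(k)})_{1\le k\le n-1}$ with ${\bf x}^{(k)},{\bf y}^{(k)}\in\mathbb R^k$ such that, with ${\bf x}^{(n)}={\bf x}$ and ${\bf y}^{(n)}={\bf y}$, $${\bf x}^{(1)}\prec{\bf x}^{(2)}\prec\dots\prec{\bf x}^{(n)},\qquad {\bf y}^{(1)}\prec{\bf y}^{(2)}\prec\dots\prec{\bf y}^{(n)},\qquad y^{(i)}_i\le x^{(\rho-i+1)}_1\quad(1\le i\le\rho).$$ For $\beta\in\mathbb R$ put $R(z)=\prod_{k=1}^n(z-x_k+\beta)$ and $\hat R_{ij}(z)=\prod_{k\ne i,j}(z-x_k+\beta)$, and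 let $\mathcal L$ be the $n\times n$ matrix (the case $\delta=n-\rho=1$) $$\mathcal L_{ij}=-\frac{\hat R_{ij}(x_i-\beta)}{R'(x_j-\beta)}\quad(i\ne j),\qquad \mathcal L_{ii}=-\frac12\,\frac{R''(x_i-\beta)}{R'(x_i-\beta)} .$$ Then the Lebesgue volume of the double cone is finite and equals $$\mathrm{Vol}\bigl(\mathcal C^{(\rho+1)}_{{\bf x},{\bf y}}\bigr)=(-1)^{n}\det\left[\frac1{n!}\left(\sum_{k=1}^n \mathcal L_{ik}\big|_{\beta=0}\,(x_k-y_j)^n\,\mathbf 1_{x_k>y_j}-R'(x_i)\big|_{\beta=0}\right)\right]_{1\le i,j\le n}.$$ -/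

import Mathlib

open MeasureTheory Polynomial

/-- `a ∈ ℝ^k` interlaces `b ∈ ℝ^(k+1)`:  `b₁ ≤ a₁ ≤ b₂ ≤ a₂ ≤ … ≤ a_k ≤ b_(k+1)`. -/
def Interlaces {k : ℕ} (a : Fin k → ℝ) (b : Fin (k + 1) → ℝ) : Prop :=
  ∀ i : Fin k, b i.castSucc ≤ a i ∧ a i ≤ b i.succ

/-- Triangular arrays with rows of lengths `1, …, m`. Row number `k` (counted from `0`) is a vector
in `ℝ^(k+1)`. As an iterated product of copies of `ℝ` this carries Lebesgue measure
in dimension `m (m + 1) / 2`. -/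
abbrev TriArray (m : ℕ) : Type := (k : Fin m) → Fin (k + 1) → ℝ

/-- The array with rows of lengths `1, …, m, m + 1`, obtained from an array `u` with
rows of lengths `1, …, m` by adding the top row `x ∈ ℝ^(m+1)`. -/
def addTopRow {m : ℕ} (u : TriArray m) (x : Fin (m + 1) → ℝ) : TriArray (m + 1) :=
  Fin.snoc (α := fun k : Fin (m + 1) => Fin (k + 1) → ℝ) u x

/-- Each row of the array interlaces the next one:
`x^(1) ≺ x^(2) ≺ … ≺ x^(m+1)`. -/
def IsInterlacing {m : ℕ} (X : TriArray (m + 1)) : Prop :=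
  ∀ k : Fin m, Interlaces (X k.castSucc) (X k.succ)

/-- The double cone with top rows `x, y ∈ ℝ^n`, `n = m + 1`, and overlap `ρ` (where `ρ ≤ n`), as a
subset of `ℝ^(n(n-1)/2) × ℝ^(n(n-1)/2) = ℝ^(n(n-1))`. The points are pairs of arrays
`(x^(1), …, x^(n-1))`, `(y^(1), …, y^(n-1))` such that, with `x^(n) = x` and `y^(n) = y`,
both `x^(1) ≺ … ≺ x^(n)` and `y^(1) ≺ … ≺ y^(n)` interlace, and the last entry of `y^(i)` is at
most the first entry of `x^(ρ-i+1)` for `1 ≤ i ≤ ρ`. In the code `y^(i)` is row number `a = i - 1`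
and `x^(ρ-i+1)` is row number `b = ρ - i`, so that the pairs are those with `a + b + 1 = ρ`. -/
def doubleCone {m : ℕ} (ρ : ℕ) (x y : Fin (m + 1) → ℝ) : Set (TriArray m × TriArray m) :=
  {p | IsInterlacing (addTopRow p.1 x) ∧ IsInterlacing (addTopRow p.2 y) ∧
    ∀ a b : Fin (m + 1), (a : ℕ) + (b : ℕ) + 1 = ρ →
      addTopRow p.2 y a (Fin.last a) ≤ addTopRow p.1 x b 0}

/-- `R(z) = ∏_k (z - x_k + β)`. -/
noncomputable def polyR {n : ℕ} (β : ℝ) (x : Fin n → ℝ) : ℝ[X] :=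
  ∏ k : Fin n, (X - C (x k) + C β)

/-- `R̂_ij(z) = ∏_{k ≠ i, j} (z - x_k + β)`. -/
noncomputable def polyRhat {n : ℕ} (β : ℝ) (x : Fin n → ℝ) (i j : Fin n) : ℝ[X] :=
  ∏ k ∈ Finset.univ.filter (fun k : Fin n => k ≠ i ∧ k ≠ j), (X - C (x k) + C β)

/-- The matrix `𝓛` with parameters `δ` and `β`:
`𝓛_ij = (-1)^δ δ R̂_ij^(δ-1)(x_i - β) / R'(x_j - β)` for `i ≠ j`, and
`𝓛_ii = (-1)^δ / (δ + 1) * R^(δ+1)(x_i - β) / R'(x_i - β)`. -/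
noncomputable def matL {n : ℕ} (δ : ℕ) (β : ℝ) (x : Fin n → ℝ) : Matrix (Fin n) (Fin n) ℝ :=
  Matrix.of fun i j =>
    if i = j then
      (-1) ^ δ / ((δ : ℝ) + 1) *
        ((derivative^[δ + 1] (polyR β x)).eval (x i - β) /
          (derivative (polyR β x)).eval (x i - β))
    else
      (-1) ^ δ * (δ : ℝ) *
        ((derivative^[δ - 1] (polyRhat β x i j)).eval (x i - β) /
          (derivative (polyR β x)).eval (x j - β))

/-! Cut the pair of arrays into levels instead of rows: append the x-row of length `i` to the y-row
of length `n - 1 - i`. The cone becomes the set of chains of `n` vectors in `ℝ^(n-1)` that start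
interlaced with `y`, end interlaced with `x`, and obey the same inequalities between all consecutive
levels. The overlap conditions are exactly the inequalities at the seam.

Tonelli then integrates level by level. The terminal condition is almost everywhere a determinant of
differences `(x_{i+1} - z_j)₊^0 - (x_i - z_j)₊^0`. A step is an integral over a box, so it can be
taken column by column; after column operations it only raises the exponent
(`det_integral_stepMatrix`). The box cut out by `y` comes last and leaves an `(n-1) × (n-1)`
determinant of mixed second differences of `(x_i - y_j)₊^n / n!` (`volume_doubleCone_eq`).

For the `n × n` formula, `-𝓛` differentiates interpolation polynomials at the nodes
(`matL_one_zero`), so its entries are `-(p_j + R)'(x_i) / n!`, where `p_j` interpolates column `j`.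
Factoring both determinants through polynomial coefficients and a Vandermonde determinant identifies
them (`det_eval_derivative`). -/

/-! ### Sorting the coordinates into levels -/

/-- Uncurrying preserves Lebesgue measure. -/
theorem measurePreserving_piCurry_symm {ι : Type*} [Fintype ι] (κ : ι → Type*)
    [∀ i, Fintype (κ i)] :
    MeasurePreserving (MeasurableEquiv.piCurry fun (i : ι) (_ : κ i) => ℝ).symm volume volume where
  measurable := MeasurableEquiv.measurable _
  map_eq := by
    refine (Measure.pi_eq fun s hs => ?_).symm
    rw [MeasurableEquiv.map_apply]
    have : (MeasurableEquiv.piCurry fun (i : ι) (_ : κ i) => ℝ).symm ⁻¹' (Set.univ.pi s) =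
        Set.univ.pi fun i => Set.univ.pi fun j => s ⟨i, j⟩ := by
      ext u
      simp [MeasurableEquiv.coe_piCurry_symm, Set.mem_pi, Sigma.uncurry, Sigma.forall]
    rw [this, volume_pi_pi]
    simp_rw [volume_pi_pi]
    rw [Fintype.prod_sigma]

/-- The coordinate permutation that sorts the entries of a pair of triangular arrays into `N + 1`
levels of length `N`; level `i` consists of a row of length `N - i` of the second array, followed
by a row of length `i` of the first one. -/
def levelEquiv (N : ℕ) :
    ((Σ b : Fin N, Fin (b + 1)) ⊕ (Σ a : Fin N, Fin (a + 1))) ≃ (Σ _ : Fin (N + 1), Fin N) where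
  toFun := Sum.elim
    (fun p => ⟨⟨p.1 + 1, by omega⟩, ⟨p.2 + (N - 1 - p.1), by omega⟩⟩)
    (fun p => ⟨⟨N - 1 - p.1, by omega⟩, ⟨p.2, by omega⟩⟩)
  invFun q :=
    if h : (q.2 : ℕ) < N - q.1 then
      Sum.inr ⟨⟨N - 1 - q.1, by omega⟩, ⟨q.2, by grind⟩⟩
    else
      Sum.inl ⟨⟨q.1 - 1, by omega⟩, ⟨q.2 - (N - q.1), by grind⟩⟩
  left_inv := by
    rintro (⟨⟨a, ha⟩, ⟨k, hk⟩⟩ | ⟨⟨a, ha⟩, ⟨k, hk⟩⟩)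
    · have h : ¬ k + (N - 1 - a) < N - (a + 1) := by dsimp only at hk; omega
      refine (dif_neg h).trans ?_
      have h1 : k + (N - 1 - a) - (N - (a + 1)) = k := by omega
      simp [h1]
    · have h : k < N - (N - 1 - a) := by dsimp only at hk; omega
      refine (dif_pos h).trans ?_
      have h1 : N - 1 - (N - 1 - a) = a := by omega
      exact congrArg Sum.inr (Sigma.ext (Fin.ext h1) ((Fin.heq_ext_iff (by simp [h1])).2 rfl))
  right_inv := by
    rintro ⟨⟨a, ha⟩, ⟨k, hk⟩⟩
    by_cases h : k < N - a
    · simp only [h, dite_true, Sum.elim_inr]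
      congr 2
      omega
    · simp only [h, dite_false, Sum.elim_inl]
      have h1 : a - 1 + 1 = a := by omega
      have h2 : k - (N - a) + (N - 1 - (a - 1)) = k := by omega
      congr 2

/-- The pair of triangular arrays whose levels are the rows of `u`. -/
def ofLevels {N : ℕ} (u : Fin (N + 1) → Fin N → ℝ) : TriArray N × TriArray N :=
  (fun b k => u ⟨b + 1, by omega⟩ ⟨k + (N - 1 - b), by omega⟩,
    fun a k => u ⟨N - 1 - a, by omega⟩ ⟨k, by omega⟩)

theorem measurePreserving_ofLevels (N : ℕ) :
    MeasurePreserving (ofLevels : (Fin (N + 1) → Fin N → ℝ) → _) volume volume := by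
  have h1 := measurePreserving_piCurry_symm (fun _ : Fin (N + 1) => Fin N)
  have h2 := (volume_measurePreserving_piCongrLeft (fun _ => ℝ) (levelEquiv N)).symm
  have h3 := volume_measurePreserving_sumPiEquivProdPi
    (fun _ : (Σ b : Fin N, Fin (b + 1)) ⊕ (Σ a : Fin N, Fin (a + 1)) => ℝ)
  have h4 := (measurePreserving_piCurry_symm (fun b : Fin N => Fin (b + 1))).symm
  -- `ofLevels` agrees with this composite by unfolding.
  exact (h4.prod h4).comp (h3.comp (h2.comp h1))

/-- One step between consecutive levels: `z₁ ≤ z'₁ ≤ z₂ ≤ z'₂ ≤ … ≤ z_N ≤ z'_N`. -/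
def LevelStep {N : ℕ} (z z' : Fin N → ℝ) : Prop :=
  ∀ j, z j ≤ z' j ∧ ∀ k : Fin N, (k : ℕ) = j + 1 → z' j ≤ z k

theorem addTopRow_of_lt {m : ℕ} (u : TriArray m) (x : Fin (m + 1) → ℝ) (k : Fin (m + 1))
    (h : (k : ℕ) < m) (j : Fin (k + 1)) : addTopRow u x k j = u ⟨k, h⟩ j := by
  simp only [addTopRow, Fin.snoc, h, dite_true]
  rfl

theorem addTopRow_last {m : ℕ} (u : TriArray m) (x : Fin (m + 1) → ℝ) :
    addTopRow u x (Fin.last m) = x := by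
  simp [addTopRow]

theorem isInterlacing_addTopRow_iff {m : ℕ} (u : TriArray (m + 1)) (x : Fin (m + 2) → ℝ) :
    IsInterlacing (addTopRow u x) ↔ IsInterlacing u ∧ Interlaces (u (Fin.last m)) x := by
  unfold IsInterlacing
  rw [Fin.forall_fin_succ']
  refine and_congr (forall_congr' fun k => ?_) ?_
  · have h1 : addTopRow u x k.castSucc.castSucc = u k.castSucc := by simp [addTopRow]
    have h2 : addTopRow u x k.castSucc.succ = u k.succ :=
      Fin.snoc_castSucc (α := fun k : Fin (m + 2) => Fin (k + 1) → ℝ) x u k.succ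
    rw [h1, h2]
  · have h1 : addTopRow u x (Fin.last m).castSucc = u (Fin.last m) := by simp [addTopRow]
    have h2 : addTopRow u x (Fin.last m).succ = x := addTopRow_last u x
    rw [h1, h2]

theorem mem_doubleCone_iff {M : ℕ} (x y : Fin (M + 2) → ℝ)
    (p : TriArray (M + 1) × TriArray (M + 1)) :
    p ∈ doubleCone (M + 1) x y ↔
      (IsInterlacing p.1 ∧ Interlaces (p.1 (Fin.last M)) x) ∧
      (IsInterlacing p.2 ∧ Interlaces (p.2 (Fin.last M)) y) ∧
      ∀ a b : Fin (M + 1), (a : ℕ) + b = M → p.2 a (Fin.last a) ≤ p.1 b 0 := by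
  unfold doubleCone
  rw [Set.mem_ofPred_eq, isInterlacing_addTopRow_iff, isInterlacing_addTopRow_iff]
  refine and_congr_right fun _ => and_congr_right fun _ => ⟨fun h a b hab => ?_, fun h a b hab => ?_⟩
  · have := h a.castSucc b.castSucc (by simp; omega)
    simpa [addTopRow] using this
  · have := h ⟨a, by omega⟩ ⟨b, by omega⟩ (by simp; omega)
    rw [addTopRow_of_lt _ _ _ (by omega), addTopRow_of_lt _ _ _ (by omega)]
    exact this

theorem ofLevels_mem_doubleCone_iff {M : ℕ} (x y : Fin (M + 2) → ℝ)
    (u : Fin (M + 2) → Fin (M + 1) → ℝ) :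
    ofLevels u ∈ doubleCone (M + 1) x y ↔
      Interlaces (u 0) y ∧ (∀ i : Fin (M + 1), LevelStep (u i.castSucc) (u i.succ)) ∧
        Interlaces (u (Fin.last _)) x := by
  -- Extending `u` to indices in `ℕ` reduces all index matching to arithmetic.
  obtain ⟨U, hU⟩ : ∃ U : ℕ → ℕ → ℝ, ∀ i k, u i k = U i k :=
    ⟨fun i k => if h : i < M + 2 ∧ k < M + 1 then u ⟨i, h.1⟩ ⟨k, h.2⟩ else 0,
      fun i k => by simp [i.is_lt, k.is_lt]⟩
  rw [mem_doubleCone_iff]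
  simp only [ofLevels, IsInterlacing, Interlaces, LevelStep, hU]
  simp only [Fin.forall_iff, Fin.val_castSucc, Fin.val_succ, Fin.val_last, Fin.val_zero,
    Fin.succ_mk, Fin.castSucc_mk]
  constructor
  · rintro ⟨⟨hx, hx'⟩, ⟨hy, hy'⟩, hc⟩
    refine ⟨?_, ?_, ?_⟩
    · intro i hi
      have := hy' i hi
      simpa using this
    · intro i hi j hj
      refine ⟨?_, fun k hk hkj => ?_⟩
      -- Left of the seam the inequality is interlacing of y-rows, at the seam the overlap
      -- condition, and to its right interlacing of x-rows.
      · rcases lt_trichotomy (i + j) M with h | h | h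
        · have := (hy (M - 1 - i) (by omega) j (by omega)).1
          rwa [show M + 1 - 1 - (M - 1 - i + 1) = i by omega,
            show M + 1 - 1 - (M - 1 - i) = i + 1 by omega] at this
        · have := hc j (by omega) i (by omega) (by omega)
          rwa [show M + 1 - 1 - j = i by omega, show 0 + (M + 1 - 1 - i) = j by omega] at this
        · have := (hx (i - 1) (by omega) (i + j - M - 1) (by omega)).2
          rwa [show i - 1 + 1 = i by omega,
            show i + j - M - 1 + (M + 1 - 1 - (i - 1)) = j by omega,
            show i + j - M - 1 + 1 + (M + 1 - 1 - i) = j by omega] at this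
      · subst hkj
        rcases lt_or_ge (i + j) M with h | h
        · have := (hy (M - 1 - i) (by omega) j (by omega)).2
          rwa [show M + 1 - 1 - (M - 1 - i + 1) = i by omega,
            show M + 1 - 1 - (M - 1 - i) = i + 1 by omega] at this
        · have := (hx (i - 1) (by omega) (i + j - M) (by omega)).1
          rwa [show i - 1 + 1 = i by omega,
            show i + j - M + (M + 1 - 1 - (i - 1)) = j + 1 by omega,
            show i + j - M + (M + 1 - 1 - i) = j by omega] at this
    · intro i hi
      have := hx' i hi
      simpa using this
  · rintro ⟨hy, hs, hx⟩
    refine ⟨⟨fun i hi j hj => ⟨?_, ?_⟩, ?_⟩, ⟨fun i hi j hj => ⟨?_, ?_⟩, ?_⟩, ?_⟩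
    · have := (hs (i + 1) (by omega) (j + (M - 1 - i)) (by omega)).2
        (j + (M - i)) (by omega) (by omega)
      rwa [show j + (M + 1 - 1 - (i + 1)) = j + (M - 1 - i) by omega,
        show j + (M + 1 - 1 - i) = j + (M - i) by omega]
    · have := (hs (i + 1) (by omega) (j + (M - i)) (by omega)).1
      rwa [show j + 1 + (M + 1 - 1 - (i + 1)) = j + (M - i) by omega,
        show j + (M + 1 - 1 - i) = j + (M - i) by omega]
    · intro i hi
      have := hx i hi
      simpa using this
    · have := (hs (M - 1 - i) (by omega) j (by omega)).1
      rwa [show M + 1 - 1 - (i + 1) = M - 1 - i by omega,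
        show M + 1 - 1 - i = M - 1 - i + 1 by omega]
    · have := (hs (M - 1 - i) (by omega) j (by omega)).2 (j + 1) (by omega) rfl
      rwa [show M + 1 - 1 - (i + 1) = M - 1 - i by omega,
        show M + 1 - 1 - i = M - 1 - i + 1 by omega]
    · intro i hi
      have := hy i hi
      simpa using this
    · intro i hi j hj hij
      have := (hs j (by omega) i (by omega)).1
      rwa [show M + 1 - 1 - i = j by omega, show 0 + (M + 1 - 1 - j) = i by omega]

/-! ### Volumes of chains by iterated integration -/

/-- The volume of the set of end pieces of chains of `s` steps starting at `z` and ending in `F`. -/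
noncomputable def chainVolume {N : ℕ} (F : Set (Fin N → ℝ)) : ℕ → (Fin N → ℝ) → ENNReal
  | 0 => F.indicator 1
  | s + 1 => fun z => ∫⁻ z' in {z' | LevelStep z z'}, chainVolume F s z'

theorem isClosed_levelStep {N : ℕ} :
    IsClosed {p : (Fin N → ℝ) × (Fin N → ℝ) | LevelStep p.1 p.2} := by
  simp only [LevelStep, Set.ofPred_forall, Set.ofPred_and]
  refine isClosed_iInter fun j => (isClosed_le (by fun_prop) (by fun_prop)).inter ?_
  exact isClosed_iInter fun k => isClosed_iInter fun _ => isClosed_le (by fun_prop) (by fun_prop)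

theorem isClosed_interlaces {N : ℕ} (x : Fin (N + 1) → ℝ) :
    IsClosed {z : Fin N → ℝ | Interlaces z x} := by
  simp only [Interlaces, Set.ofPred_forall, Set.ofPred_and]
  exact isClosed_iInter fun j => (isClosed_le (by fun_prop) (by fun_prop)).inter
    (isClosed_le (by fun_prop) (by fun_prop))

theorem measurableSet_levelStep {N : ℕ} (z : Fin N → ℝ) :
    MeasurableSet {z' : Fin N → ℝ | LevelStep z z'} :=
  (isClosed_levelStep.preimage (f := fun z' => (z, z')) (by fun_prop)).measurableSet

/-- The set of chains of `s` steps that start in `A` and end in `F`. -/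
def chainSet {N : ℕ} (A F : Set (Fin N → ℝ)) (s : ℕ) : Set (Fin (s + 1) → Fin N → ℝ) :=
  {v | v 0 ∈ A ∧ (∀ i : Fin s, LevelStep (v i.castSucc) (v i.succ)) ∧ v (Fin.last s) ∈ F}

theorem measurableSet_chainSet {N : ℕ} {A F : Set (Fin N → ℝ)} (hA : MeasurableSet A)
    (hF : MeasurableSet F) (s : ℕ) : MeasurableSet (chainSet A F s) := by
  refine (hA.preimage (measurable_pi_apply 0)).inter (MeasurableSet.inter ?_
    (hF.preimage (measurable_pi_apply (Fin.last s))))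
  change MeasurableSet {v : Fin (s + 1) → Fin N → ℝ | ∀ i : Fin s, _}
  rw [Set.ofPred_forall]
  exact MeasurableSet.iInter fun i => (isClosed_levelStep.preimage
    (f := fun v : Fin (s + 1) → Fin N → ℝ => (v i.castSucc, v i.succ)) (by fun_prop)).measurableSet

/-- Tonelli, splitting off the first level. The starting set stays arbitrary because the induction
restarts from the set of successors of `z`. -/
theorem volume_chainSet {N : ℕ} {F : Set (Fin N → ℝ)} (hF : MeasurableSet F) (s : ℕ) :
    ∀ A : Set (Fin N → ℝ), MeasurableSet A →
      volume (chainSet A F s) = ∫⁻ z in A, chainVolume F s z := by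
  induction s with
  | zero =>
    intro A hA
    have h := (volume_preserving_funUnique (Fin 1) (Fin N → ℝ)).measure_preimage
      (hA.inter hF).nullMeasurableSet
    have h2 : chainSet A F 0 = MeasurableEquiv.funUnique (Fin 1) (Fin N → ℝ) ⁻¹' (A ∩ F) := by
      ext v
      simp [chainSet]
    rw [h2]
    refine h.trans ?_
    simp only [chainVolume]
    rw [lintegral_indicator_one hF, Measure.restrict_apply hF, Set.inter_comm]
  | succ s ih =>
    intro A hA
    have hmp := (volume_preserving_piFinSuccAbove (fun _ : Fin (s + 2) => Fin N → ℝ) 0).symm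
    rw [← hmp.measure_preimage (measurableSet_chainSet hA hF (s + 1)).nullMeasurableSet]
    rw [Measure.volume_eq_prod, Measure.prod_apply
      (hmp.measurable (measurableSet_chainSet hA hF (s + 1))), ← lintegral_indicator hA]
    refine lintegral_congr fun z => ?_
    by_cases hz : z ∈ A
    · rw [Set.indicator_of_mem hz]
      simp only [chainVolume]
      rw [← ih _ (measurableSet_levelStep z)]
      congr 1
      ext v
      simp [chainSet, hz, Fin.forall_fin_succ, MeasurableEquiv.piFinSuccAbove, and_assoc]
    · rw [Set.indicator_of_notMem hz]
      convert measure_empty (μ := volume)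
      ext v
      simp [chainSet, hz, MeasurableEquiv.piFinSuccAbove]

theorem isClosed_doubleCone {M : ℕ} (x y : Fin (M + 2) → ℝ) :
    IsClosed (doubleCone (M + 1) x y) := by
  have h : doubleCone (M + 1) x y = {p | (IsInterlacing p.1 ∧ Interlaces (p.1 (Fin.last M)) x) ∧
      (IsInterlacing p.2 ∧ Interlaces (p.2 (Fin.last M)) y) ∧
      ∀ a b : Fin (M + 1), (a : ℕ) + b = M → p.2 a (Fin.last a) ≤ p.1 b 0} :=
    Set.ext (mem_doubleCone_iff x y)
  rw [h]
  simp only [IsInterlacing, Interlaces, Set.ofPred_forall, Set.ofPred_and]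
  repeat' first
    | apply IsClosed.inter
    | (refine isClosed_iInter fun _ => ?_)
    | exact isClosed_le (by fun_prop) (by fun_prop)

theorem volume_doubleCone {M : ℕ} (x y : Fin (M + 2) → ℝ) :
    volume (doubleCone (M + 1) x y) =
      ∫⁻ z in {z | Interlaces z y}, chainVolume {z | Interlaces z x} (M + 1) z := by
  rw [← volume_chainSet (isClosed_interlaces x).measurableSet _ _
    (isClosed_interlaces y).measurableSet]
  have h : ofLevels ⁻¹' doubleCone (M + 1) x y =
      chainSet {z | Interlaces z y} {z | Interlaces z x} (M + 1) := by
    ext u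
    exact ofLevels_mem_doubleCone_iff x y u
  rw [← h, (measurePreserving_ofLevels (M + 1)).measure_preimage (isClosed_doubleCone x y).nullMeasurableSet]

/-! ### Truncated powers and their integrals -/

/-- The truncated power `(a - z)₊ ^ s / s!`. -/
noncomputable def truncPow (s : ℕ) (a z : ℝ) : ℝ :=
  if z < a then (a - z) ^ s / s.factorial else 0

theorem truncPow_eq_indicator (s : ℕ) (a : ℝ) :
    truncPow s a = (Set.Iio a).indicator fun z => (a - z) ^ s / s.factorial := by
  ext z; simp [truncPow, Set.indicator]

theorem integrableOn_truncPow_Ici (s : ℕ) (a z : ℝ) :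
    IntegrableOn (truncPow s a) (Set.Ici z) := by
  rw [truncPow_eq_indicator, IntegrableOn, integrable_indicator_iff measurableSet_Iio, IntegrableOn,
    Measure.restrict_restrict measurableSet_Iio]
  have : Set.Iio a ∩ Set.Ici z ⊆ Set.Icc z a := fun t ht => ⟨ht.2, le_of_lt ht.1⟩
  have hc : Continuous fun t : ℝ => (a - t) ^ s / (s.factorial : ℝ) := by fun_prop
  exact hc.integrableOn_Icc.mono_set this

theorem setIntegral_truncPow_Ici (s : ℕ) (a z : ℝ) :
    ∫ t in Set.Ici z, truncPow s a t = truncPow (s + 1) a z := by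
  rw [truncPow_eq_indicator, integral_indicator measurableSet_Iio,
    Measure.restrict_restrict measurableSet_Iio, Set.inter_comm, Set.Ici_inter_Iio]
  by_cases h : z < a
  · rw [integral_Ico_eq_integral_Ioc, ← intervalIntegral.integral_of_le h.le,
      intervalIntegral.integral_div,
      intervalIntegral.integral_comp_sub_left (fun t => t ^ s), integral_pow, truncPow, if_pos h]
    simp [Nat.factorial_succ]
    field_simp
  · rw [Set.Ico_eq_empty h]
    simp [truncPow, h]

theorem setIntegral_truncPow_Icc (s : ℕ) (a : ℝ) {z w : ℝ} (h : z ≤ w) :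
    ∫ t in Set.Icc z w, truncPow s a t = truncPow (s + 1) a z - truncPow (s + 1) a w := by
  rw [← setIntegral_truncPow_Ici, ← setIntegral_truncPow_Ici, integral_Icc_eq_integral_Ico,
    ← Set.Ico_union_Ici_eq_Ici h, setIntegral_union _ measurableSet_Ici]
  · ring
  · exact (integrableOn_truncPow_Ici s a z).mono_set Set.Ico_subset_Ici_self
  · exact integrableOn_truncPow_Ici s a w
  · rw [Set.disjoint_left]
    intro t ht ht'
    exact absurd ht.2 (not_lt.2 ht')

/-! ### Determinants integrated over boxes -/

section BoxIntegral

variable {N : ℕ} {φ : Fin N → ℝ → ℝ} {I : Fin N → Set ℝ}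

theorem integrableOn_det_box (hφ : ∀ i j, IntegrableOn (φ i) (I j)) :
    IntegrableOn (fun z : Fin N → ℝ => (Matrix.of fun i j => φ i (z j)).det)
      (Set.univ.pi I) := by
  simp only [Matrix.det_apply', Matrix.of_apply]
  rw [IntegrableOn, volume_pi, Measure.restrict_pi_pi]
  refine integrable_finsetSum _ fun σ _ =>
    Integrable.const_mul (Integrable.fintype_prod fun j => hφ (σ j) j) _

/-- Column `j` depends on `z j` alone, so each Leibniz term is a product of one-variable functions
and Fubini applies. -/
theorem setIntegral_det_box (hφ : ∀ i j, IntegrableOn (φ i) (I j)) :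
    ∫ z in Set.univ.pi I, (Matrix.of fun i j => φ i (z j)).det =
      (Matrix.of fun i j => ∫ t in I j, φ i t).det := by
  simp only [Matrix.det_apply', Matrix.of_apply]
  rw [volume_pi, Measure.restrict_pi_pi, integral_finsetSum]
  · refine Finset.sum_congr rfl fun σ _ => ?_
    rw [integral_const_mul, integral_fintype_prod_eq_prod (fun j => φ (σ j))]
  · exact fun σ _ => Integrable.const_mul (Integrable.fintype_prod fun j => hφ (σ j) j) _

theorem setLIntegral_ofReal_det_box (hI : ∀ j, MeasurableSet (I j))
    (hφ : ∀ i j, IntegrableOn (φ i) (I j))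
    (h0 : ∀ z ∈ Set.univ.pi I, 0 ≤ (Matrix.of fun i j => φ i (z j)).det) :
    ∫⁻ z in Set.univ.pi I, ENNReal.ofReal (Matrix.of fun i j => φ i (z j)).det =
      ENNReal.ofReal (Matrix.of fun i j => ∫ t in I j, φ i t).det := by
  rw [← setIntegral_det_box hφ, ofReal_integral_eq_lintegral_ofReal (integrableOn_det_box hφ)]
  exact (ae_restrict_iff' (MeasurableSet.univ_pi hI)).2 (.of_forall h0)

end BoxIntegral

/-- Column operations: subtracting from each column the next one. -/
theorem det_sub_succ_col {M : ℕ} (A B : Matrix (Fin (M + 1)) (Fin (M + 1)) ℝ)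
    (hlast : ∀ i, B i (Fin.last M) = A i (Fin.last M))
    (h : ∀ i (j : Fin M), B i j.castSucc = A i j.castSucc - A i j.succ) : B.det = A.det := by
  -- Reversing the indices turns "next column" into "previous column".
  have hr : ∀ C : Matrix (Fin (M + 1)) (Fin (M + 1)) ℝ,
      (C.submatrix Fin.revPerm Fin.revPerm).det = C.det := fun C =>
    Matrix.det_submatrix_equiv_self _ _
  rw [← hr A, ← hr B]
  refine (Matrix.det_eq_of_forall_col_eq_smul_add_pred (fun _ => 1) (fun i => ?_)
    fun i j => ?_).symm
  · simp [hlast]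
  · simp [Fin.rev_succ, Fin.rev_castSucc, h]

/-! ### Evolution of the determinant along a chain -/

/-- The matrix with entries `(x_{i+1} - z_j)₊^s / s! - (x_i - z_j)₊^s / s!`. -/
noncomputable def stepMatrix {N : ℕ} (s : ℕ) (x : Fin (N + 1) → ℝ) (z : Fin N → ℝ) :
    Matrix (Fin N) (Fin N) ℝ :=
  Matrix.of fun i j => truncPow s (x i.succ) (z j) - truncPow s (x i.castSucc) (z j)

theorem stepMatrix_zero_apply {N : ℕ} {x : Fin (N + 1) → ℝ} (hx : Monotone x) (z : Fin N → ℝ)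
    (i j : Fin N) :
    stepMatrix 0 x z i j = if x i.castSucc ≤ z j ∧ z j < x i.succ then 1 else 0 := by
  have := hx (Fin.castSucc_lt_succ (i := i)).le
  simp only [stepMatrix, truncPow, Matrix.of_apply, pow_zero, Nat.factorial_zero, Nat.cast_one,
    div_one]
  split_ifs <;> grind

/-- The entries are indicators of half-open intervals ordered like their indices, so with `z`
monotone only the identity permutation can contribute. -/
theorem det_stepMatrix_zero {N : ℕ} {x : Fin (N + 1) → ℝ} (hx : Monotone x) {z : Fin N → ℝ}
    (hz : Monotone z) :
    (stepMatrix 0 x z).det = if ∀ j : Fin N, x j.castSucc ≤ z j ∧ z j < x j.succ then 1 else 0 := by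
  rw [Matrix.det_apply, Finset.sum_eq_single 1]
  · simp only [Equiv.Perm.sign_one, one_smul, Equiv.Perm.one_apply, stepMatrix_zero_apply hx]
    rw [Finset.prod_ite_zero]
    simp
  · intro σ _ hσ
    by_contra hne
    have hp : ∀ i, x (σ i).castSucc ≤ z i ∧ z i < x (σ i).succ := by
      intro i
      by_contra hi
      apply hne
      rw [Finset.prod_eq_zero (Finset.mem_univ i), smul_zero]
      rw [stepMatrix_zero_apply hx, if_neg hi]
    have hmono : Monotone σ := by
      intro i j hij
      by_contra hlt
      rw [not_le] at hlt
      -- An inversion would give `x_{σj+1} ≤ x_{σi} ≤ z_i ≤ z_j < x_{σj+1}`.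
      have h1 := hx (show (σ j).succ ≤ (σ i).castSucc from hlt)
      linarith [hz hij, (hp i).1, (hp j).2]
    have hs : StrictMono σ := hmono.strictMono_of_injective σ.injective
    apply hσ
    have := Subsingleton.elim (hs.orderIsoOfSurjective σ σ.surjective) (OrderIso.refl _)
    ext i
    exact congrArg Fin.val (DFunLike.congr_fun this i)
  · simp

/-- The interval of admissible values of the entry `z'_j` in a step from `z` to `z'`. -/
def stepInterval {M : ℕ} (z : Fin (M + 1) → ℝ) : Fin (M + 1) → Set ℝ :=
  Fin.lastCases (Set.Ici (z (Fin.last M))) fun j => Set.Icc (z j.castSucc) (z j.succ)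

theorem setOf_levelStep {M : ℕ} (z : Fin (M + 1) → ℝ) :
    {z' | LevelStep z z'} = Set.univ.pi (stepInterval z) := by
  ext z'
  simp only [LevelStep, stepInterval, Set.mem_ofPred_eq, Set.mem_univ_pi, Fin.forall_fin_succ',
    Fin.lastCases_castSucc, Fin.lastCases_last, Set.mem_Ici, Set.mem_Icc]
  refine and_congr (forall_congr' fun j => and_congr_right fun _ => ⟨fun h => ?_, fun h => ?_⟩) ?_
  · rcases Fin.eq_castSucc_or_eq_last j.succ with ⟨k, hk⟩ | hk
    · rw [hk]
      exact h.1 k (by simpa using (congrArg Fin.val hk).symm)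
    · rw [hk]
      exact h.2 (by simpa using (congrArg Fin.val hk).symm)
  · refine ⟨fun k hk => ?_, fun hk => ?_⟩
    · rwa [show k.castSucc = j.succ from Fin.ext (by simpa using hk)]
    · rwa [show Fin.last M = j.succ from Fin.ext (by simpa using hk)]
  · refine and_iff_left ⟨fun k hk => ?_, fun hk => ?_⟩
    · simp at hk; omega
    · simp at hk

theorem monotone_of_levelStep {M : ℕ} {z z' : Fin (M + 1) → ℝ} (h : LevelStep z z') :
    Monotone z' := by
  rw [Fin.monotone_iff_le_succ]
  intro j
  exact ((h j.castSucc).2 j.succ (by simp)).trans (h j.succ).1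

/-- Over `[z_j, z_{j+1}]` a column integrates to a difference of neighbouring columns with exponent
`s + 1`; the last one, over a half-line, to the column itself. Column operations undo the
differences. -/
theorem det_integral_stepMatrix {M : ℕ} (s : ℕ) (x : Fin (M + 2) → ℝ) {z : Fin (M + 1) → ℝ}
    (hz : Monotone z) :
    (Matrix.of fun i j => ∫ t in stepInterval z j,
      (truncPow s (x i.succ) t - truncPow s (x i.castSucc) t)).det =
      (stepMatrix (s + 1) x z).det := by
  refine det_sub_succ_col _ _ (fun i => ?_) fun i j => ?_
  · simp only [Matrix.of_apply, stepInterval, Fin.lastCases_last, stepMatrix]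
    rw [integral_sub (integrableOn_truncPow_Ici _ _ _) (integrableOn_truncPow_Ici _ _ _),
      setIntegral_truncPow_Ici, setIntegral_truncPow_Ici]
  · simp only [Matrix.of_apply, stepInterval, Fin.lastCases_castSucc, stepMatrix]
    have h := hz (Fin.castSucc_lt_succ (i := j)).le
    rw [integral_sub ((integrableOn_truncPow_Ici _ _ _).mono_set Set.Icc_subset_Ici_self)
      ((integrableOn_truncPow_Ici _ _ _).mono_set Set.Icc_subset_Ici_self),
      setIntegral_truncPow_Icc _ _ h, setIntegral_truncPow_Icc _ _ h]
    ring

theorem integrableOn_stepInterval {M : ℕ} (s : ℕ) (x : Fin (M + 2) → ℝ) (z : Fin (M + 1) → ℝ)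
    (i j : Fin (M + 1)) :
    IntegrableOn (fun t => truncPow s (x i.succ) t - truncPow s (x i.castSucc) t)
      (stepInterval z j) := by
  have h : stepInterval z j ⊆ Set.Ici (z j) := by
    refine Fin.lastCases ?_ (fun j => ?_) j
    · simp [stepInterval]
    · simp [stepInterval, Set.Icc_subset_Ici_self]
  exact ((integrableOn_truncPow_Ici _ _ _).mono_set h).sub
    ((integrableOn_truncPow_Ici _ _ _).mono_set h)

theorem measurableSet_stepInterval {M : ℕ} (z : Fin (M + 1) → ℝ) (j : Fin (M + 1)) :
    MeasurableSet (stepInterval z j) := by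
  refine Fin.lastCases ?_ (fun j => ?_) j
  · simp [stepInterval]
  · simp [stepInterval]

theorem setLIntegral_det_stepMatrix {M : ℕ} (s : ℕ) (x : Fin (M + 2) → ℝ) {z : Fin (M + 1) → ℝ}
    (hz : Monotone z) (h0 : ∀ z' : Fin (M + 1) → ℝ, Monotone z' → 0 ≤ (stepMatrix s x z').det) :
    ∫⁻ z' in {z' | LevelStep z z'}, ENNReal.ofReal (stepMatrix s x z').det =
      ENNReal.ofReal (stepMatrix (s + 1) x z).det := by
  rw [← det_integral_stepMatrix s x hz, setOf_levelStep]
  refine setLIntegral_ofReal_det_box (measurableSet_stepInterval z)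
    (integrableOn_stepInterval s x z) fun z' hz' => h0 z' ?_
  rw [← setOf_levelStep] at hz'
  exact monotone_of_levelStep hz'

theorem det_stepMatrix_nonneg {M : ℕ} {x : Fin (M + 2) → ℝ} (hx : Monotone x) (s : ℕ) :
    ∀ z : Fin (M + 1) → ℝ, Monotone z → 0 ≤ (stepMatrix s x z).det := by
  induction s with
  | zero =>
    intro z hz
    rw [det_stepMatrix_zero hx hz]
    split_ifs <;> simp
  | succ s ih =>
    intro z hz
    rw [← det_integral_stepMatrix s x hz, ← setIntegral_det_box (integrableOn_stepInterval s x z)]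
    refine setIntegral_nonneg (MeasurableSet.univ_pi (measurableSet_stepInterval z))
      fun z' hz' => ih z' ?_
    rw [← setOf_levelStep] at hz'
    exact monotone_of_levelStep hz'

/-- The exceptional null set arises only at `s = 0`, where closed interlacing intervals meet
half-open ones; the next integration removes it. -/
theorem ae_chainVolume_eq {M : ℕ} {x : Fin (M + 2) → ℝ} (hx : Monotone x) (s : ℕ) :
    ∀ᵐ z : Fin (M + 1) → ℝ, Monotone z →
      chainVolume {z | Interlaces z x} s z = ENNReal.ofReal (stepMatrix s x z).det := by
  induction s with
  | zero =>
    have h : ∀ᵐ z : Fin (M + 1) → ℝ, ∀ j, z j ≠ x j.succ :=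
      ae_all_iff.2 fun j => Measure.ae_eval_ne (fun _ => volume) j _
    filter_upwards [h] with z hne hz
    have hiff : Interlaces z x ↔ ∀ j, x j.castSucc ≤ z j ∧ z j < x j.succ :=
      forall_congr' fun j => and_congr_right fun _ => ⟨fun h => lt_of_le_of_ne h (hne j), le_of_lt⟩
    rw [det_stepMatrix_zero hx hz]
    simp only [chainVolume, Set.indicator, Set.mem_ofPred_eq, hiff]
    split_ifs <;> simp
  | succ s ih =>
    refine .of_forall fun z hz => ?_
    rw [← setLIntegral_det_stepMatrix s x hz (det_stepMatrix_nonneg hx s)]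
    refine setLIntegral_congr_fun_ae (measurableSet_levelStep z) ?_
    filter_upwards [ih] with z' hz' hs
    exact hz' (monotone_of_levelStep hs)

theorem volume_doubleCone_eq {M : ℕ} {x y : Fin (M + 2) → ℝ} (hx : Monotone x) (hy : Monotone y) :
    ∃ D : ℝ, 0 ≤ D ∧ volume (doubleCone (M + 1) x y) = ENNReal.ofReal D ∧
    D = (Matrix.of fun i j : Fin (M + 1) =>
        (truncPow (M + 2) (x i.succ) (y j.castSucc) - truncPow (M + 2) (x i.succ) (y j.succ)) -
        (truncPow (M + 2) (x i.castSucc) (y j.castSucc) -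
          truncPow (M + 2) (x i.castSucc) (y j.succ))).det := by
  have hbox : {z : Fin (M + 1) → ℝ | Interlaces z y} =
      Set.univ.pi fun j => Set.Icc (y j.castSucc) (y j.succ) := by
    ext z; simp only [Interlaces, Set.mem_ofPred_eq, Set.mem_univ_pi, Set.mem_Icc]
  have hmono : ∀ z ∈ {z : Fin (M + 1) → ℝ | Interlaces z y}, Monotone z := by
    intro z hz
    rw [Fin.monotone_iff_le_succ]
    intro j
    exact (hz j.castSucc).2.trans (hz j.succ).1
  have hint : ∀ a (j : Fin (M + 1)), IntegrableOn (truncPow (M + 1) a)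
      (Set.Icc (y j.castSucc) (y j.succ)) := fun a j =>
    (integrableOn_truncPow_Ici _ _ _).mono_set Set.Icc_subset_Ici_self
  have hD : (Matrix.of fun i j : Fin (M + 1) => ∫ t in Set.Icc (y j.castSucc) (y j.succ),
      (truncPow (M + 1) (x i.succ) t - truncPow (M + 1) (x i.castSucc) t)) =
      (Matrix.of fun i j : Fin (M + 1) =>
        (truncPow (M + 2) (x i.succ) (y j.castSucc) - truncPow (M + 2) (x i.succ) (y j.succ)) -
        (truncPow (M + 2) (x i.castSucc) (y j.castSucc) -
          truncPow (M + 2) (x i.castSucc) (y j.succ))) := by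
    ext i j
    have h := hy (Fin.castSucc_lt_succ (i := j)).le
    simp only [Matrix.of_apply]
    rw [integral_sub (hint _ _) (hint _ _), setIntegral_truncPow_Icc _ _ h,
      setIntegral_truncPow_Icc _ _ h]
  have hint' : ∀ i j : Fin (M + 1), IntegrableOn (fun t => truncPow (M + 1) (x i.succ) t -
      truncPow (M + 1) (x i.castSucc) t) (Set.Icc (y j.castSucc) (y j.succ)) :=
    fun i j => (hint (x i.succ) j).sub (hint (x i.castSucc) j)
  rw [← hD]
  refine ⟨_, ?_, ?_, rfl⟩
  · rw [← setIntegral_det_box hint', ← hbox]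
    exact setIntegral_nonneg (isClosed_interlaces y).measurableSet
      fun z hz => det_stepMatrix_nonneg hx (M + 1) z (hmono z hz)
  · rw [volume_doubleCone, ← setLIntegral_ofReal_det_box (fun j => measurableSet_Icc) hint', ← hbox]
    · refine setLIntegral_congr_fun_ae (isClosed_interlaces y).measurableSet ?_
      filter_upwards [ae_chainVolume_eq hx (M + 1)] with z hz hs
      exact hz (hmono z hs)
    · rw [← hbox]
      exact fun z hz => det_stepMatrix_nonneg hx (M + 1) z (hmono z hz)

/-! ### Lagrange interpolation and the `n × n` determinant -/

theorem polyR_zero {n : ℕ} (x : Fin n → ℝ) : polyR 0 x = Lagrange.nodal Finset.univ x := by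
  simp [polyR, Lagrange.nodal_eq]

theorem basis_eq_C_mul_nodal {n : ℕ} (x : Fin n → ℝ) (k : Fin n) :
    Lagrange.basis Finset.univ x k =
      C ((derivative (Lagrange.nodal Finset.univ x)).eval (x k))⁻¹ *
        Lagrange.nodal (Finset.univ.erase k) x := by
  rw [Lagrange.basis_eq_prod_sub_inv_mul_nodal_div (Finset.mem_univ k),
    Lagrange.nodalWeight_eq_eval_derivative_nodal (Finset.mem_univ k),
    ← Lagrange.nodal_erase_eq_nodal_div (Finset.mem_univ k)]

/-- At `δ = 1`, `β = 0` the matrix `𝓛` is minus the differentiation matrix of Lagrange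
interpolation in the nodes `x`. -/
theorem matL_one_zero {n : ℕ} (x : Fin n → ℝ) (i k : Fin n) :
    matL 1 0 x i k = -(derivative (Lagrange.basis Finset.univ x k)).eval (x i) := by
  rw [basis_eq_C_mul_nodal, derivative_C_mul, eval_C_mul]
  simp only [matL, Matrix.of_apply, polyR_zero, sub_zero]
  split_ifs with h
  · subst h
    -- Writing `R = (z - x_i) Q` gives `R''(x_i) = 2 Q'(x_i)`, which absorbs the factor `1/2`.
    have h2 : (derivative^[1 + 1] (Lagrange.nodal Finset.univ x)).eval (x i) =
        2 * (derivative (Lagrange.nodal (Finset.univ.erase i) x)).eval (x i) := by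
      rw [Lagrange.nodal_eq_mul_nodal_erase (Finset.mem_univ i)]
      simp [Function.iterate_succ, derivative_mul]
      ring
    rw [h2]
    push_cast
    ring
  · have h2 : (derivative (Lagrange.nodal (Finset.univ.erase k) x)).eval (x i) =
        (polyRhat 0 x i k).eval (x i) := by
      rw [Lagrange.eval_nodal_derivative_eval_node_eq (Finset.mem_erase.2 ⟨h, Finset.mem_univ i⟩)]
      have : (Finset.univ.erase k).erase i = Finset.univ.filter fun l => l ≠ i ∧ l ≠ k := by
        ext l; simp
      rw [this]
      simp [polyRhat, Lagrange.nodal_eq]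
    rw [h2]
    simp
    ring

/-- The determinant of the matrix of first differences of the powers `x_i ^ m`, `m ≥ 1`. -/
theorem det_pow_sub_pow {N : ℕ} (x : Fin (N + 1) → ℝ) :
    (Matrix.of fun i m : Fin N => x i.succ ^ ((m : ℕ) + 1) - x i.castSucc ^ ((m : ℕ) + 1)).det =
      (Matrix.vandermonde x).det := by
  let B : Matrix (Fin (N + 1)) (Fin (N + 1)) ℝ := Matrix.of fun i m =>
    Fin.cases (x 0 ^ (m : ℕ)) (fun i : Fin N => x i.succ ^ (m : ℕ) - x i.castSucc ^ (m : ℕ)) i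
  have h : (Matrix.vandermonde x).det = B.det :=
    Matrix.det_eq_of_forall_row_eq_smul_add_pred (fun _ => 1)
      (fun j => by simp [B, Matrix.vandermonde_apply])
      fun i j => by simp [B, Matrix.vandermonde_apply]
  rw [h, Matrix.det_succ_column_zero, Finset.sum_eq_single 0]
  · simp [B]
    rfl
  · intro i _ hi
    obtain ⟨j, rfl⟩ := Fin.exists_succ_eq.2 hi
    simp [B]
  · simp

/-- Column differences leave only the corner entry in the last row; its cofactor sign is `+`. -/
theorem det_of_last_row_one {N : ℕ} (A : Matrix (Fin (N + 1)) (Fin (N + 1)) ℝ)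
    (h : ∀ j, A (Fin.last N) j = 1) :
    A.det = (Matrix.of fun m j : Fin N => A m.castSucc j.castSucc - A m.castSucc j.succ).det := by
  let B : Matrix (Fin (N + 1)) (Fin (N + 1)) ℝ := Matrix.of fun i =>
    Fin.lastCases (A i (Fin.last N)) fun j => A i j.castSucc - A i j.succ
  have hB : B.det = A.det :=
    det_sub_succ_col A B (fun i => by simp [B]) fun i j => by simp [B]
  rw [← hB, Matrix.det_succ_row _ (Fin.last N), Finset.sum_eq_single (Fin.last N)]
  · simp [B, h, ← two_mul]
    congr 1
    ext m j
    simp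
  · intro j _ hj
    obtain ⟨k, rfl⟩ := Fin.exists_castSucc_eq.2 hj
    simp [B, h]
  · simp

/-- Let `q_j` be polynomials of degree at most `n = N + 1` with leading term `z ^ n`. The derivatives
at the nodes give the same determinant, up to `n!`, as the second differences of the values. -/
theorem det_eval_derivative {N : ℕ} (x : Fin (N + 1) → ℝ) (p : Fin (N + 1) → ℝ[X]) (r : ℝ[X])
    (hp : ∀ j, (p j).natDegree ≤ N) (hr : r.Monic) (hrn : r.natDegree = N + 1) :
    (Matrix.of fun i j => (derivative (p j + r)).eval (x i)).det =
      (N + 1).factorial * (Matrix.of fun i j : Fin N =>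
        ((p j.castSucc).eval (x i.succ) - (p j.succ).eval (x i.succ)) -
        ((p j.castSucc).eval (x i.castSucc) - (p j.succ).eval (x i.castSucc))).det := by
  have h1 : (Matrix.of fun i j => (derivative (p j + r)).eval (x i)) =
      Matrix.vandermonde x * (Matrix.diagonal (fun m : Fin (N + 1) => ((m : ℕ) : ℝ) + 1) *
        Matrix.of fun (m : Fin (N + 1)) j => (p j + r).coeff ((m : ℕ) + 1)) := by
    ext i j
    have hd : (derivative (p j + r)).natDegree < N + 1 := by
      refine (natDegree_derivative_le _).trans_lt ?_
      have : (p j + r).natDegree ≤ N + 1 :=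
        natDegree_add_le_of_degree_le ((hp j).trans N.le_succ) hrn.le
      omega
    rw [Matrix.mul_apply, Matrix.of_apply, eval_eq_sum_range' hd, Finset.sum_range]
    refine Finset.sum_congr rfl fun m _ => ?_
    rw [Matrix.diagonal_mul, Matrix.vandermonde_apply, Matrix.of_apply, coeff_derivative]
    ring
  have h2 : (Matrix.of fun i j : Fin N =>
        ((p j.castSucc).eval (x i.succ) - (p j.succ).eval (x i.succ)) -
        ((p j.castSucc).eval (x i.castSucc) - (p j.succ).eval (x i.castSucc))) =
      (Matrix.of fun i m : Fin N => x i.succ ^ ((m : ℕ) + 1) - x i.castSucc ^ ((m : ℕ) + 1)) *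
      Matrix.of fun m j : Fin N =>
        (p j.castSucc).coeff ((m : ℕ) + 1) - (p j.succ).coeff ((m : ℕ) + 1) := by
    ext i j
    -- The constant coefficient is kept apart because it cancels in differences over the nodes.
    have he : ∀ j t, (p j).eval t =
        ∑ m : Fin N, (p j).coeff ((m : ℕ) + 1) * t ^ ((m : ℕ) + 1) + (p j).coeff 0 := by
      intro j t
      rw [eval_eq_sum_range' (Nat.lt_succ_of_le (hp j)), Finset.sum_range_succ', Finset.sum_range,
        pow_zero, mul_one]
    simp only [Matrix.mul_apply, Matrix.of_apply, he]
    simp only [add_sub_add_right_eq_sub, add_sub_add_comm, ← Finset.sum_sub_distrib]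
    exact Finset.sum_congr rfl fun m _ => by ring
  -- Here the `R'` term matters: adding a monic polynomial of degree `N + 1` makes the top
  -- coefficient row constantly one.
  have hlast : ∀ j, (p j + r).coeff (N + 1) = 1 := by
    intro j
    rw [coeff_add, coeff_eq_zero_of_natDegree_lt (Nat.lt_succ_of_le (hp j)), zero_add, ← hrn]
    exact hr
  rw [h1, h2, Matrix.det_mul, Matrix.det_mul, Matrix.det_mul, det_pow_sub_pow, Matrix.det_diagonal,
    det_of_last_row_one (Matrix.of fun (m : Fin (N + 1)) j => (p j + r).coeff ((m : ℕ) + 1)) hlast]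
  have h3 : ∏ m : Fin (N + 1), (((m : ℕ) : ℝ) + 1) = ((N + 1).factorial : ℝ) := by
    rw [← Finset.prod_range_add_one_eq_factorial, Finset.prod_range]
    push_cast
    rfl
  rw [h3]
  simp only [Matrix.of_apply, coeff_add, Fin.val_castSucc, add_sub_add_right_eq_sub]
  ring

theorem det_matL_eq {N : ℕ} {x : Fin (N + 1) → ℝ} (hx : Function.Injective x)
    (f : Fin (N + 1) → Fin (N + 1) → ℝ) :
    (-1) ^ (N + 1) * (Matrix.of fun i j : Fin (N + 1) =>
        (1 / ((N + 1).factorial : ℝ)) *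
          ((∑ k, matL 1 0 x i k * f k j) - (derivative (polyR 0 x)).eval (x i))).det =
      (Matrix.of fun i j : Fin N =>
        (f i.succ j.castSucc / (N + 1).factorial - f i.succ j.succ / (N + 1).factorial) -
        (f i.castSucc j.castSucc / (N + 1).factorial -
          f i.castSucc j.succ / (N + 1).factorial)).det := by
  set p : Fin (N + 1) → ℝ[X] := fun j => Lagrange.interpolate Finset.univ x fun k => f k j with hpdef
  have hp : ∀ j, (p j).natDegree ≤ N := fun j => by
    have := Lagrange.degree_interpolate_le (s := Finset.univ) (fun k => f k j) hx.injOn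
    exact natDegree_le_of_degree_le (by rwa [Finset.card_univ, Fintype.card_fin,
      Nat.add_sub_cancel] at this)
  have hpe : ∀ k j, (p j).eval (x k) = f k j := fun k j =>
    Lagrange.eval_interpolate_at_node _ hx.injOn (Finset.mem_univ k)
  have hF : ((N + 1).factorial : ℝ) ≠ 0 := by positivity
  have hA : (Matrix.of fun i j : Fin (N + 1) =>
        (1 / ((N + 1).factorial : ℝ)) *
          ((∑ k, matL 1 0 x i k * f k j) - (derivative (polyR 0 x)).eval (x i))) =
      (-(1 / ((N + 1).factorial : ℝ))) • Matrix.of fun i j =>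
        (derivative (p j + polyR 0 x)).eval (x i) := by
    ext i j
    simp only [Matrix.of_apply, Matrix.smul_apply, smul_eq_mul, derivative_add, eval_add, hpdef,
      Lagrange.interpolate_apply, derivative_sum, derivative_C_mul, eval_finsetSum, eval_C_mul,
      matL_one_zero]
    rw [neg_mul, ← mul_neg, neg_add, ← Finset.sum_neg_distrib, sub_eq_add_neg]
    congr 3
    funext k
    ring
  have hB : (Matrix.of fun i j : Fin N =>
        (f i.succ j.castSucc / (N + 1).factorial - f i.succ j.succ / (N + 1).factorial) -
        (f i.castSucc j.castSucc / (N + 1).factorial -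
          f i.castSucc j.succ / (N + 1).factorial)) =
      (1 / ((N + 1).factorial : ℝ)) • Matrix.of fun i j : Fin N =>
        ((p j.castSucc).eval (x i.succ) - (p j.succ).eval (x i.succ)) -
        ((p j.castSucc).eval (x i.castSucc) - (p j.succ).eval (x i.castSucc)) := by
    ext i j
    simp only [Matrix.of_apply, Matrix.smul_apply, smul_eq_mul, hpe]
    ring
  rw [hA, hB, Matrix.det_smul, Matrix.det_smul, det_eval_derivative x p _ hp
    (by rw [polyR_zero]; exact Lagrange.nodal_monic)
    (by rw [polyR_zero, Lagrange.natDegree_nodal]; simp)]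
  have hsign : (-1 : ℝ) ^ (N + 1) * (-1) ^ (N + 1) = 1 := by rw [← mul_pow]; simp
  -- Scaling the larger matrix costs one more factor `1 / n!`, which the `n!` from the derivatives
  -- cancels.
  have hpow : (1 / ((N + 1).factorial : ℝ)) ^ (N + 1) * (N + 1).factorial =
      (1 / ((N + 1).factorial : ℝ)) ^ N := by
    rw [pow_succ, mul_assoc, one_div_mul_cancel hF, mul_one]
  rw [Fintype.card_fin, Fintype.card_fin, neg_pow (1 / _), ← hpow, ← mul_assoc, ← mul_assoc,
    ← mul_assoc, hsign, one_mul]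

theorem corollary7p2 (ρ : ℕ) (hρ : 1 ≤ ρ) (x y : Fin (ρ + 1) → ℝ)
    (hx : StrictMono x) (hy : Monotone y) :
    volume (doubleCone ρ x y) ≠ ⊤ ∧
    (volume (doubleCone ρ x y)).toReal =
      (-1) ^ (ρ + 1) * Matrix.det (Matrix.of fun i j : Fin (ρ + 1) =>
        (1 / ((ρ + 1).factorial : ℝ)) *
          ((∑ k : Fin (ρ + 1), matL 1 0 x i k *
              (if y j < x k then (x k - y j) ^ (ρ + 1) else 0))
            - (derivative (polyR 0 x)).eval (x i))) := by
  obtain ⟨M, rfl⟩ : ∃ M, ρ = M + 1 := ⟨ρ - 1, by omega⟩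
  obtain ⟨D, hD, hvol, hdet⟩ := volume_doubleCone_eq hx.monotone hy
  refine ⟨by rw [hvol]; exact ENNReal.ofReal_ne_top, ?_⟩
  rw [det_matL_eq hx.injective fun k j => if y j < x k then (x k - y j) ^ (M + 1 + 1) else 0, hvol,
    ENNReal.toReal_ofReal hD, hdet]
  simp only [truncPow, ite_div, zero_div]
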